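/- Let $\mathbf T=\begin{pmatrix}a&b\\c&d\end{pmatrix}$ with $a,b,c,d\in\mathbb C$, and let $A_{\mathbf T}$ be the operator $A_{\mathbf T}f=-f''$ (derivatives taken on $\mathbb R\setminus\{0\}$) in $L_2(\mathbb R)$ with domain $$\mathcal D(A_{\mathbf T})=\{f\in W_2^2(\mathbb R\setminus\{0\})\ :\ \mathbf T\,\Gamma_0f=\Gamma_1f\},$$ $$\Gamma_0f=\frac12\begin{pmatrix}f(+0)+f(-0)\\-f'(+0)-f'(-0)\end{pmatrix},\qquad \Gamma_1f=\begin{pmatrix}f'(+0)-f'(-0)\\f(+0)-f(-0)\end{pmatrix}.$$ Put $p_{\mathbf T}(\tau)=2d\tau^2+i(\det\mathbf T-4)\tau+2a$ and $\mathbb C_{++}=\{\tau\in\mathbb C:\operatorname{Re}\tau>0,\ \operatorname{Im}\tau>0\}$. Suppose that $A_{\mathbf T}$ is similar to a self-adjoint operator, i.e. $A_{\mathbf T}=Z^{-1}HZ$ for some (possibly unbounded) self-adjoint operator $H$ in $L_2(\mathbb R)$ and some bounded and boundedly invertible operator $Z$ in $L_2(\mathbb R)$. Then $p_{\mathbf T}$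 has no zeros in $\mathbb C_{++}$, and the functions $$\Phi_{\pm}(\tau)=\frac{(\operatorname{Re}\tau)^2}{|\tau|^2}\cdot\frac{|2d\tau^2+i\tau(\det\mathbf T\mp2c)|^2+|i\tau(\det\mathbf T\pm2b)+2a|^2}{|p_{\mathbf T}(\tau)|^2}$$ are uniformly bounded on $\mathbb C_{++}$: there exists $K>0$ such that $\Phi_+(\tau)<K$ and $\Phi_-(\tau)<K$ for all $\tau\in\mathbb C_{++}$. -/

import Mathlib

open MeasureTheory Set Filter Topology
open scoped ContDiff Matrix

noncomputable section

namespace ZeroRange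

/-- The complex Hilbert space `L²(ℝ)` with Lebesgue measure. -/
abbrev L2R : Type := Lp ℂ 2 (volume : Measure ℝ)

/-- `g` is the weak derivative of `f` on the open set `ℝ \ {0}`: the test functions are the smooth
functions whose compact support does not contain `0`. -/
def HasWeakDeriv (f g : L2R) : Prop :=
  ∀ φ : ℝ → ℝ, ContDiff ℝ ∞ φ → HasCompactSupport φ → tsupport φ ⊆ {0}ᶜ →
    ∫ x, deriv φ x • f x = -∫ x, φ x • g x

/-- `f(+0) = v`: the limit at `0` from the right of the continuous representative of `f` on
`(0, ∞)`. -/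
def HasRightValue (f : L2R) (v : ℂ) : Prop :=
  ∃ u : ℝ → ℂ, ContinuousOn u (Ioi 0) ∧ (∀ᵐ x : ℝ, x ∈ Ioi (0 : ℝ) → f x = u x) ∧
    Tendsto u (𝓝[>] 0) (𝓝 v)

/-- `f(-0) = v`: the limit at `0` from the left of the continuous representative of `f` on
`(-∞, 0)`. -/
def HasLeftValue (f : L2R) (v : ℂ) : Prop :=
  ∃ u : ℝ → ℂ, ContinuousOn u (Iio 0) ∧ (∀ᵐ x : ℝ, x ∈ Iio (0 : ℝ) → f x = u x) ∧
    Tendsto u (𝓝[<] 0) (𝓝 v)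

/-- `Γ₀` in terms of the one-sided values `f(+0), f(-0), f'(+0), f'(-0)`. -/
def Gamma0 (fp fm dfp dfm : ℂ) : Fin 2 → ℂ := ![(fp + fm) / 2, (-dfp - dfm) / 2]

/-- `Γ₁` in terms of the one-sided values `f(+0), f(-0), f'(+0), f'(-0)`. -/
def Gamma1 (fp fm dfp dfm : ℂ) : Fin 2 → ℂ := ![dfp - dfm, fp - fm]

/-- The boundary condition `T Γ₀ f = Γ₁ f` for a function `f` with derivative `f'` on `ℝ \ {0}`.
For `f` in `W₂²(ℝ \ {0})` the four one-sided values always exist, and they are unique. -/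
def BoundaryCondition (T : Matrix (Fin 2) (Fin 2) ℂ) (f f' : L2R) : Prop :=
  ∃ fp fm dfp dfm : ℂ, HasRightValue f fp ∧ HasLeftValue f fm ∧
    HasRightValue f' dfp ∧ HasLeftValue f' dfm ∧
    T *ᵥ Gamma0 fp fm dfp dfm = Gamma1 fp fm dfp dfm

lemma integrable_smul_of_test {ψ : ℝ → ℝ} (hψ : Continuous ψ) (hc : HasCompactSupport ψ)
    (f : L2R) : Integrable (fun x => ψ x • f x) :=
  ((Lp.memLp f).locallyIntegrable (by norm_num)).integrable_smul_left_of_hasCompactSupport hψ hc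

lemma HasWeakDeriv.zero : HasWeakDeriv 0 0 := by
  intro φ _ _ _
  have h (ψ : ℝ → ℝ) : ∫ x, ψ x • (0 : L2R) x = 0 := by
    rw [← integral_zero ℝ ℂ (μ := volume)]
    refine integral_congr_ae ?_
    filter_upwards [Lp.coeFn_zero ℂ 2 (volume : Measure ℝ)] with x hx
    rw [hx, Pi.zero_apply, smul_zero]
  rw [h, h, neg_zero]

lemma HasWeakDeriv.add {f g f' g' : L2R} (hf : HasWeakDeriv f f') (hg : HasWeakDeriv g g') :
    HasWeakDeriv (f + g) (f' + g') := by
  intro φ h1 h2 h3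
  have key (ψ : ℝ → ℝ) (hψ : Continuous ψ) (hc : HasCompactSupport ψ) (u v : L2R) :
      ∫ x, ψ x • (u + v) x = (∫ x, ψ x • u x) + ∫ x, ψ x • v x := by
    rw [← integral_add (integrable_smul_of_test hψ hc u) (integrable_smul_of_test hψ hc v)]
    refine integral_congr_ae ?_
    filter_upwards [Lp.coeFn_add u v] with x hx
    rw [hx, Pi.add_apply, smul_add]
  rw [key _ (h1.continuous_deriv (by simp)) h2.deriv, key _ h1.continuous h2,
    hf φ h1 h2 h3, hg φ h1 h2 h3, neg_add]

lemma HasWeakDeriv.smul (c : ℂ) {f f' : L2R} (hf : HasWeakDeriv f f') :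
    HasWeakDeriv (c • f) (c • f') := by
  intro φ h1 h2 h3
  have key (ψ : ℝ → ℝ) (u : L2R) : ∫ x, ψ x • (c • u) x = c • ∫ x, ψ x • u x := by
    rw [← integral_smul]
    refine integral_congr_ae ?_
    filter_upwards [Lp.coeFn_smul c u] with x hx
    rw [hx, Pi.smul_apply, smul_comm]
  rw [key, key, hf φ h1 h2 h3, smul_neg]

lemma HasWeakDeriv.unique {f g h : L2R} (hg : HasWeakDeriv f g) (hh : HasWeakDeriv f h) :
    g = h := by
  have hgh : HasWeakDeriv 0 (g - h) := by
    have := hg.add (hh.smul (-1))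
    simpa [sub_eq_add_neg] using this
  have h0 : ∀ᵐ x : ℝ, x ∈ ({0}ᶜ : Set ℝ) → (g - h) x = 0 := by
    refine IsOpen.ae_eq_zero_of_integral_contDiff_smul_eq_zero isOpen_compl_singleton
      (((Lp.memLp (g - h)).locallyIntegrable (by norm_num)).locallyIntegrableOn _) ?_
    intro φ h1 h2 h3
    have e := hgh φ h1 h2 h3
    have z : ∫ x, deriv φ x • (0 : L2R) x = 0 := by
      rw [← integral_zero ℝ ℂ (μ := volume)]
      refine integral_congr_ae ?_
      filter_upwards [Lp.coeFn_zero ℂ 2 (volume : Measure ℝ)] with x hx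
      rw [hx, Pi.zero_apply, smul_zero]
    rw [z] at e
    exact neg_eq_zero.mp e.symm
  have hne : ∀ᵐ x : ℝ, x ≠ 0 := by simp [ae_iff]
  rw [← sub_eq_zero]
  refine Lp.ext ?_
  filter_upwards [h0, hne, Lp.coeFn_zero ℂ 2 (volume : Measure ℝ)] with x hx hx0 hz
  rw [hx hx0, hz]
  rfl

lemma HasRightValue.zero : HasRightValue 0 0 :=
  ⟨fun _ => 0, continuousOn_const,
    by filter_upwards [Lp.coeFn_zero ℂ 2 (volume : Measure ℝ)] with x hx _ using hx,
    tendsto_const_nhds⟩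

lemma HasLeftValue.zero : HasLeftValue 0 0 :=
  ⟨fun _ => 0, continuousOn_const,
    by filter_upwards [Lp.coeFn_zero ℂ 2 (volume : Measure ℝ)] with x hx _ using hx,
    tendsto_const_nhds⟩

lemma HasRightValue.add {f g : L2R} {v w : ℂ} (hf : HasRightValue f v) (hg : HasRightValue g w) :
    HasRightValue (f + g) (v + w) := by
  obtain ⟨u, hu, hfu, hut⟩ := hf
  obtain ⟨u', hu', hgu, hut'⟩ := hg
  refine ⟨fun x => u x + u' x, hu.add hu', ?_, hut.add hut'⟩
  filter_upwards [hfu, hgu, Lp.coeFn_add f g] with x h1 h2 h3 hx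
  rw [h3, Pi.add_apply, h1 hx, h2 hx]

lemma HasLeftValue.add {f g : L2R} {v w : ℂ} (hf : HasLeftValue f v) (hg : HasLeftValue g w) :
    HasLeftValue (f + g) (v + w) := by
  obtain ⟨u, hu, hfu, hut⟩ := hf
  obtain ⟨u', hu', hgu, hut'⟩ := hg
  refine ⟨fun x => u x + u' x, hu.add hu', ?_, hut.add hut'⟩
  filter_upwards [hfu, hgu, Lp.coeFn_add f g] with x h1 h2 h3 hx
  rw [h3, Pi.add_apply, h1 hx, h2 hx]

lemma HasRightValue.smul (c : ℂ) {f : L2R} {v : ℂ} (hf : HasRightValue f v) :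
    HasRightValue (c • f) (c * v) := by
  obtain ⟨u, hu, hfu, hut⟩ := hf
  refine ⟨fun x => c * u x, continuousOn_const.mul hu, ?_, hut.const_mul c⟩
  filter_upwards [hfu, Lp.coeFn_smul c f] with x h1 h3 hx
  rw [h3, Pi.smul_apply, h1 hx, smul_eq_mul]

lemma HasLeftValue.smul (c : ℂ) {f : L2R} {v : ℂ} (hf : HasLeftValue f v) :
    HasLeftValue (c • f) (c * v) := by
  obtain ⟨u, hu, hfu, hut⟩ := hf
  refine ⟨fun x => c * u x, continuousOn_const.mul hu, ?_, hut.const_mul c⟩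
  filter_upwards [hfu, Lp.coeFn_smul c f] with x h1 h3 hx
  rw [h3, Pi.smul_apply, h1 hx, smul_eq_mul]

lemma BoundaryCondition.zero (T : Matrix (Fin 2) (Fin 2) ℂ) : BoundaryCondition T 0 0 := by
  refine ⟨0, 0, 0, 0, .zero, .zero, .zero, .zero, ?_⟩
  have h0 : Gamma0 0 0 0 0 = 0 := by ext i; fin_cases i <;> simp [Gamma0]
  have h1 : Gamma1 0 0 0 0 = 0 := by ext i; fin_cases i <;> simp [Gamma1]
  rw [h0, h1, Matrix.mulVec_zero]

lemma BoundaryCondition.add {T : Matrix (Fin 2) (Fin 2) ℂ} {f f' g g' : L2R}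
    (hf : BoundaryCondition T f f') (hg : BoundaryCondition T g g') :
    BoundaryCondition T (f + g) (f' + g') := by
  obtain ⟨p, m, p', m', h1, h2, h3, h4, h⟩ := hf
  obtain ⟨q, n, q', n', k1, k2, k3, k4, k⟩ := hg
  refine ⟨p + q, m + n, p' + q', m' + n', h1.add k1, h2.add k2, h3.add k3, h4.add k4, ?_⟩
  have e0 : Gamma0 (p + q) (m + n) (p' + q') (m' + n')
      = Gamma0 p m p' m' + Gamma0 q n q' n' := by
    ext i; fin_cases i <;> simp [Gamma0] <;> ring
  have e1 : Gamma1 (p + q) (m + n) (p' + q') (m' + n')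
      = Gamma1 p m p' m' + Gamma1 q n q' n' := by
    ext i; fin_cases i <;> simp [Gamma1] <;> ring
  rw [e0, e1, Matrix.mulVec_add, h, k]

lemma BoundaryCondition.smul (c : ℂ) {T : Matrix (Fin 2) (Fin 2) ℂ} {f f' : L2R}
    (hf : BoundaryCondition T f f') : BoundaryCondition T (c • f) (c • f') := by
  obtain ⟨p, m, p', m', h1, h2, h3, h4, h⟩ := hf
  refine ⟨c * p, c * m, c * p', c * m', h1.smul c, h2.smul c, h3.smul c, h4.smul c, ?_⟩
  have e0 : Gamma0 (c * p) (c * m) (c * p') (c * m') = c • Gamma0 p m p' m' := by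
    ext i; fin_cases i <;> simp [Gamma0] <;> ring
  have e1 : Gamma1 (c * p) (c * m) (c * p') (c * m') = c • Gamma1 p m p' m' := by
    ext i; fin_cases i <;> simp [Gamma1] <;> ring
  rw [e0, e1, Matrix.mulVec_smul, h]

/-- The domain `{f ∈ W₂²(ℝ \ {0}) | T Γ₀ f = Γ₁ f}`, where `W₂²(ℝ \ {0})` consists of the
`f ∈ L²(ℝ)` that have two weak derivatives in `L²` on `ℝ \ {0}`. -/
def domain (T : Matrix (Fin 2) (Fin 2) ℂ) : Submodule ℂ L2R where
  carrier := {f | ∃ f' f'' : L2R, HasWeakDeriv f f' ∧ HasWeakDeriv f' f'' ∧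
    BoundaryCondition T f f'}
  zero_mem' := ⟨0, 0, .zero, .zero, .zero T⟩
  add_mem' := by
    rintro f g ⟨f', f'', h1, h2, h3⟩ ⟨g', g'', k1, k2, k3⟩
    exact ⟨f' + g', f'' + g'', h1.add k1, h2.add k2, h3.add k3⟩
  smul_mem' := by
    rintro c f ⟨f', f'', h1, h2, h3⟩
    exact ⟨c • f', c • f'', h1.smul c, h2.smul c, h3.smul c⟩

lemma exists_secondDeriv {T : Matrix (Fin 2) (Fin 2) ℂ} (f : domain T) :
    ∃ f'' f' : L2R, HasWeakDeriv f f' ∧ HasWeakDeriv f' f'' := by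
  obtain ⟨_, f', f'', h1, h2, _⟩ := f
  exact ⟨f'', f', h1, h2⟩

/-- The second weak derivative on `ℝ \ {0}` of an element of the domain. -/
def secondDeriv {T : Matrix (Fin 2) (Fin 2) ℂ} (f : domain T) : L2R :=
  (exists_secondDeriv f).choose

lemma secondDeriv_eq {T : Matrix (Fin 2) (Fin 2) ℂ} {f : domain T} {f' f'' : L2R}
    (h1 : HasWeakDeriv f f') (h2 : HasWeakDeriv f' f'') : secondDeriv f = f'' := by
  obtain ⟨g', k1, k2⟩ := (exists_secondDeriv f).choose_spec
  rw [k1.unique h1] at k2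
  exact k2.unique h2

/-- The operator `A_T = -d²/dx²` in `L²(ℝ)` with domain `domain T`. -/
def operator (T : Matrix (Fin 2) (Fin 2) ℂ) : L2R →ₗ.[ℂ] L2R where
  domain := domain T
  toFun :=
    { toFun := fun f => -secondDeriv f
      map_add' := by
        intro f g
        obtain ⟨f', h1, h2⟩ := (exists_secondDeriv f).choose_spec
        obtain ⟨g', k1, k2⟩ := (exists_secondDeriv g).choose_spec
        rw [secondDeriv_eq (f := f + g) (h1.add k1) (h2.add k2), neg_add]
        rfl
      map_smul' := by
        intro c f
        obtain ⟨f', h1, h2⟩ := (exists_secondDeriv f).choose_spec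
        rw [secondDeriv_eq (f := c • f) (h1.smul c) (h2.smul c), RingHom.id_apply, smul_neg]
        rfl }

/-- `(f, g)` belongs to the graph of `A_T` exactly when `f` is in the domain and `g = -f''`. -/
lemma mem_graph_operator {T : Matrix (Fin 2) (Fin 2) ℂ} {f g : L2R} :
    (f, g) ∈ (operator T).graph ↔
      ∃ f' f'' : L2R, HasWeakDeriv f f' ∧ HasWeakDeriv f' f'' ∧ BoundaryCondition T f f' ∧
        g = -f'' := by
  rw [LinearPMap.mem_graph_iff]
  constructor
  · rintro ⟨⟨y, f', f'', h1, h2, h3⟩, rfl, rfl⟩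
    exact ⟨f', f'', h1, h2, h3, congrArg Neg.neg (secondDeriv_eq h1 h2)⟩
  · rintro ⟨f', f'', h1, h2, h3, rfl⟩
    have hf : f ∈ domain T := ⟨f', f'', h1, h2, h3⟩
    exact ⟨⟨f, hf⟩, rfl, congrArg Neg.neg (secondDeriv_eq (f := ⟨f, hf⟩) h1 h2)⟩

/-- `A` is similar to a self-adjoint operator: `A = Z⁻¹ H Z` (equality of operators, with
`D(A) = Z⁻¹ D(H)`) for a self-adjoint, possibly unbounded operator `H` in the same Hilbert space
and a bounded and boundedly invertible operator `Z`. -/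
def IsSimilarToSelfAdjoint {E : Type*} [NormedAddCommGroup E] [InnerProductSpace ℂ E]
    [CompleteSpace E] (A : E →ₗ.[ℂ] E) : Prop :=
  ∃ (H : E →ₗ.[ℂ] E) (Z : E ≃L[ℂ] E), IsSelfAdjoint H ∧
    (∀ f : E, f ∈ A.domain ↔ Z f ∈ H.domain) ∧
    ∀ (f : A.domain) (h : H.domain), (h : E) = Z (f : E) → A f = Z.symm (H h)

/-- `p_T(τ) = 2dτ² + i(det T - 4)τ + 2a`, for `T` with rows `(a, b)` and `(c, d)`. -/
def p (a b c d τ : ℂ) : ℂ :=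
  2 * d * τ ^ 2 + Complex.I * ((!![a, b; c, d]).det - 4) * τ + 2 * a

/-- The function `Φ₊`. -/
def PhiPlus (a b c d τ : ℂ) : ℝ :=
  τ.re ^ 2 / ‖τ‖ ^ 2 *
    ((‖2 * d * τ ^ 2 + Complex.I * τ * ((!![a, b; c, d]).det - 2 * c)‖ ^ 2 +
      ‖Complex.I * τ * ((!![a, b; c, d]).det + 2 * b) + 2 * a‖ ^ 2) / ‖p a b c d τ‖ ^ 2)

/-- The function `Φ₋`. -/
def PhiMinus (a b c d τ : ℂ) : ℝ :=
  τ.re ^ 2 / ‖τ‖ ^ 2 *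
    ((‖2 * d * τ ^ 2 + Complex.I * τ * ((!![a, b; c, d]).det + 2 * c)‖ ^ 2 +
      ‖Complex.I * τ * ((!![a, b; c, d]).det - 2 * b) + 2 * a‖ ^ 2) / ‖p a b c d τ‖ ^ 2)

end ZeroRange

end

/-! Similarity to a self-adjoint operator gives `|Im z| ‖f‖ ≤ M ‖(A_T - z) f‖` on the domain with
`M` independent of `z`. Only this inequality is used, never the full resolvent.

It is tested at `z = τ²` on `f = e + k`, where on each half-line `k` is a multiple of the decaying
solution of `-k'' = τ² k` and `e` a multiple of its complex conjugate. Then `(A_T - z) f` is `τ² -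
(conj τ)²` times `e`, up to sign, and the modulus of that factor is `2 |Im z|`. Moreover `e` and `k`
decay at the same rate, so their norms depend on their coefficients in the same way. Hence the
coefficients of `k` are bounded by those of `e`, uniformly in `τ` (`exists_coeff_bound`).

If `p_T(τ) = 0`, some nonzero `k` alone satisfies the boundary condition, contradicting the bound
with `e = 0`. Otherwise `e` is placed on one half-line with amplitude of modulus `1 / (2 Re τ)`. The
mean `s` and jump `q` of `f` at `0` solve a 2×2 system with determinant `-p_T(τ)/2`; they are `O(1 /
Re τ)`, and the quotients in `Φ±` are expressed through `s` and `q`. The right half-line gives `Φ₊`,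
the left one `Φ₋`. -/

/-! ### Resolvent estimate under similarity -/

/-- A self-adjoint operator `H` satisfies `|Im z| ‖h‖ ≤ ‖(H - z) h‖`. -/
lemma IsSelfAdjoint.abs_im_mul_norm_le {E : Type*} [NormedAddCommGroup E]
    [InnerProductSpace ℂ E] [CompleteSpace E] {H : E →ₗ.[ℂ] E} (hH : IsSelfAdjoint H) (z : ℂ)
    (h : H.domain) : |z.im| * ‖(h : E)‖ ≤ ‖H h - z • (h : E)‖ := by
  have hsymm : H.IsFormalAdjoint H := by
    have := H.adjoint_isFormalAdjoint hH.dense_domain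
    rwa [LinearPMap.isSelfAdjoint_def.mp hH] at this
  have hreal : (inner ℂ (h : E) (H h)).im = 0 := by
    rw [← Complex.conj_eq_iff_im, inner_conj_symm]
    exact hsymm h h
  -- As `⟨h, H h⟩` is real, only `z` contributes to the imaginary part; Cauchy–Schwarz then gives
  -- the bound.
  have him : (inner ℂ (h : E) (H h - z • (h : E))).im = -(z.im * ‖(h : E)‖ ^ 2) := by
    rw [inner_sub_right, inner_smul_right, inner_self_eq_norm_sq_to_K, Complex.sub_im, hreal,
      zero_sub, neg_inj]
    change (z * (‖(h : E)‖ : ℂ) ^ 2).im = _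
    rw [← Complex.ofReal_pow, Complex.im_mul_ofReal]
  have hle : |z.im| * ‖(h : E)‖ ^ 2 ≤ ‖(h : E)‖ * ‖H h - z • (h : E)‖ := by
    calc |z.im| * ‖(h : E)‖ ^ 2 = |(inner ℂ (h : E) (H h - z • (h : E))).im| := by
          rw [him, abs_neg, abs_mul, abs_of_nonneg (sq_nonneg ‖(h : E)‖)]
      _ ≤ ‖inner ℂ (h : E) (H h - z • (h : E))‖ := Complex.abs_im_le_norm _
      _ ≤ _ := norm_inner_le_norm _ _
  rcases (norm_nonneg (h : E)).eq_or_lt with h0 | h0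
  · rw [← h0, mul_zero]
    exact norm_nonneg _
  · refine le_of_mul_le_mul_left ?_ h0
    linarith [hle]

namespace ZeroRange

/-- Conjugation by `Z` costs only the factor `‖Z⁻¹‖ ‖Z‖`, which does not depend on `z`. -/
lemma IsSimilarToSelfAdjoint.exists_abs_im_mul_norm_le {E : Type*} [NormedAddCommGroup E]
    [InnerProductSpace ℂ E] [CompleteSpace E] {A : E →ₗ.[ℂ] E} (hA : IsSimilarToSelfAdjoint A) :
    ∃ M : ℝ, 0 ≤ M ∧ ∀ (z : ℂ) (f : A.domain),
      |z.im| * ‖(f : E)‖ ≤ M * ‖A f - z • (f : E)‖ := by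
  obtain ⟨H, Z, hH, hdom, happ⟩ := hA
  refine ⟨‖(Z.symm : E →L[ℂ] E)‖ * ‖(Z : E →L[ℂ] E)‖, by positivity, fun z f => ?_⟩
  let h : H.domain := ⟨Z f, (hdom f).mp f.2⟩
  have e : H h - z • (h : E) = Z (A f - z • (f : E)) := by
    rw [happ f h rfl, map_sub, map_smul, Z.apply_symm_apply]
  calc |z.im| * ‖(f : E)‖ = |z.im| * ‖(Z.symm : E →L[ℂ] E) (h : E)‖ := by simp [h]
    _ ≤ |z.im| * (‖(Z.symm : E →L[ℂ] E)‖ * ‖(h : E)‖) := by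
        gcongr; exact ContinuousLinearMap.le_opNorm _ _
    _ = ‖(Z.symm : E →L[ℂ] E)‖ * (|z.im| * ‖(h : E)‖) := by ring
    _ ≤ ‖(Z.symm : E →L[ℂ] E)‖ * ‖H h - z • (h : E)‖ := by
        gcongr; exact hH.abs_im_mul_norm_le z h
    _ ≤ ‖(Z.symm : E →L[ℂ] E)‖ * (‖(Z : E →L[ℂ] E)‖ * ‖A f - z • (f : E)‖) := by
        rw [e]; gcongr; exact (Z : E →L[ℂ] E).le_opNorm _
    _ = _ := by ring

/-! ### One-sided exponentials in `L²(ℝ)` -/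

/-- Integration by parts on a half-line: `hint` is applied to `φ u`, which vanishes at `0` because
the support of `φ` avoids `0`, so a jump of the indicator at `0` is harmless. -/
lemma hasWeakDeriv_of_indicator {S : Set ℝ} (hS : MeasurableSet S)
    (hint : ∀ F : ℝ → ℂ, ContDiff ℝ 1 F → HasCompactSupport F → F 0 = 0 →
      ∫ x in S, deriv F x = 0)
    {u : ℝ → ℂ} (hu : ContDiff ℝ 1 u) {f g : L2R} (hf : f =ᵐ[volume] S.indicator u)
    (hg : g =ᵐ[volume] S.indicator (deriv u)) : HasWeakDeriv f g := by
  intro φ h1 h2 h3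
  have hφ : ContDiff ℝ 1 φ := h1.of_le (by exact_mod_cast le_top)
  have h0 : φ 0 = 0 := image_eq_zero_of_notMem_tsupport fun h => h3 h rfl
  have key := hint (fun x => φ x • u x) (hφ.smul hu) h2.smul_right (by simp [h0])
  have hd (x : ℝ) : deriv (fun x => φ x • u x) x = φ x • deriv u x + deriv φ x • u x :=
    deriv_fun_smul (hφ.differentiable (by simp) x) (hu.differentiable (by simp) x)
  simp_rw [hd] at key
  have hcu := hu.continuous
  have hcu' := hu.continuous_deriv (by simp)
  have hcφ' := hφ.continuous_deriv (by simp)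
  have i1 : Integrable fun x => φ x • deriv u x :=
    (hφ.continuous.smul hcu').integrable_of_hasCompactSupport h2.smul_right
  have i2 : Integrable fun x => deriv φ x • u x :=
    (hcφ'.smul hcu).integrable_of_hasCompactSupport h2.deriv.smul_right
  rw [integral_add i1.integrableOn i2.integrableOn] at key
  have conv (ψ : ℝ → ℝ) (v : L2R) (w : ℝ → ℂ) (hv : v =ᵐ[volume] S.indicator w) :
      ∫ x, ψ x • v x = ∫ x in S, ψ x • w x := by
    rw [← integral_indicator hS]
    refine integral_congr_ae ?_
    filter_upwards [hv] with x hx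
    rw [hx]
    by_cases h : x ∈ S <;> simp [h]
  rw [conv _ _ _ hf, conv _ _ _ hg]
  linear_combination key

lemma hasDerivAt_exp_mul (m : ℂ) (x : ℝ) :
    HasDerivAt (fun x : ℝ => Complex.exp (m * x)) (m * Complex.exp (m * x)) x := by
  have := ((hasDerivAt_id (x : ℂ)).const_mul m).cexp.comp_ofReal
  simpa [mul_comm] using this

lemma contDiff_exp_mul (m : ℂ) : ContDiff ℝ 1 fun x : ℝ => Complex.exp (m * x) :=
  (contDiff_const.mul Complex.ofRealCLM.contDiff).cexp

lemma deriv_exp_mul (m : ℂ) :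
    deriv (fun x : ℝ => Complex.exp (m * x)) = fun x : ℝ => m * Complex.exp (m * x) :=
  funext fun x => (hasDerivAt_exp_mul m x).deriv

lemma norm_exp_mul_sq (m : ℂ) (x : ℝ) :
    ‖Complex.exp (m * x)‖ ^ 2 = Real.exp (2 * m.re * x) := by
  rw [Complex.norm_exp, ← Real.exp_nat_mul]
  congr 1
  simp
  ring

lemma memLp_indicator_exp_mul {S : Set ℝ} (hS : MeasurableSet S) {m : ℂ}
    (h : IntegrableOn (fun x : ℝ => Real.exp (2 * m.re * x)) S) :
    MemLp (S.indicator fun x : ℝ => Complex.exp (m * x)) 2 volume := by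
  rw [memLp_indicator_iff_restrict hS,
    memLp_two_iff_integrable_sq_norm (contDiff_exp_mul m).continuous.aestronglyMeasurable]
  simp only [norm_exp_mul_sq]
  exact h

lemma memLp_expRight {μ : ℂ} (hμ : 0 < μ.re) :
    MemLp ((Ioi 0).indicator fun x : ℝ => Complex.exp (-μ * x)) 2 volume :=
  memLp_indicator_exp_mul measurableSet_Ioi
    (integrableOn_exp_mul_Ioi (by simpa using hμ) 0)

lemma memLp_expLeft {μ : ℂ} (hμ : 0 < μ.re) :
    MemLp ((Iio 0).indicator fun x : ℝ => Complex.exp (μ * x)) 2 volume :=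
  memLp_indicator_exp_mul measurableSet_Iio
    ((integrableOn_exp_mul_Iic (by simpa using hμ) 0).mono_set Iio_subset_Iic_self)

noncomputable section

/-- The element `x ↦ exp (-μ x)` for `x > 0`, and `0` for `x < 0`, of `L²(ℝ)`. -/
def expRight (μ : ℂ) (hμ : 0 < μ.re) : L2R := (memLp_expRight hμ).toLp _

/-- The element `x ↦ exp (μ x)` for `x < 0`, and `0` for `x > 0`, of `L²(ℝ)`. -/
def expLeft (μ : ℂ) (hμ : 0 < μ.re) : L2R := (memLp_expLeft hμ).toLp _

end

section

variable {μ : ℂ} (hμ : 0 < μ.re)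

lemma coeFn_expRight :
    expRight μ hμ =ᵐ[volume] (Ioi 0).indicator fun x : ℝ => Complex.exp (-μ * x) :=
  MemLp.coeFn_toLp _

lemma coeFn_expLeft :
    expLeft μ hμ =ᵐ[volume] (Iio 0).indicator fun x : ℝ => Complex.exp (μ * x) :=
  MemLp.coeFn_toLp _

lemma hasWeakDeriv_expRight : HasWeakDeriv (expRight μ hμ) (-μ • expRight μ hμ) := by
  refine hasWeakDeriv_of_indicator measurableSet_Ioi (fun F hF hc h0 => ?_)
    (contDiff_exp_mul (-μ)) (coeFn_expRight hμ) ?_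
  · rw [hc.integral_Ioi_deriv_eq hF, h0, neg_zero]
  · rw [deriv_exp_mul]
    filter_upwards [Lp.coeFn_smul (-μ) (expRight μ hμ), coeFn_expRight hμ] with x h1 h2
    rw [h1, Pi.smul_apply, h2]
    by_cases h : x ∈ Ioi (0 : ℝ) <;> simp [h]

lemma hasWeakDeriv_expLeft : HasWeakDeriv (expLeft μ hμ) (μ • expLeft μ hμ) := by
  refine hasWeakDeriv_of_indicator measurableSet_Iio (fun F hF hc h0 => ?_)
    (contDiff_exp_mul μ) (coeFn_expLeft hμ) ?_
  · rw [← integral_Iic_eq_integral_Iio, hc.integral_Iic_deriv_eq hF, h0]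
  · rw [deriv_exp_mul]
    filter_upwards [Lp.coeFn_smul μ (expLeft μ hμ), coeFn_expLeft hμ] with x h1 h2
    rw [h1, Pi.smul_apply, h2]
    by_cases h : x ∈ Iio (0 : ℝ) <;> simp [h]

lemma tendsto_exp_mul_nhdsWithin_zero (m : ℂ) (S : Set ℝ) :
    Tendsto (fun x : ℝ => Complex.exp (m * x)) (𝓝[S] 0) (𝓝 1) := by
  have := ((contDiff_exp_mul m).continuous.tendsto 0).mono_left (nhdsWithin_le_nhds (s := S))
  simpa using this

lemma hasRightValue_expRight : HasRightValue (expRight μ hμ) 1 := by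
  refine ⟨_, (contDiff_exp_mul (-μ)).continuous.continuousOn, ?_,
    tendsto_exp_mul_nhdsWithin_zero _ _⟩
  filter_upwards [coeFn_expRight hμ] with x hx h
  rw [hx, indicator_of_mem h]

lemma hasLeftValue_expLeft : HasLeftValue (expLeft μ hμ) 1 := by
  refine ⟨_, (contDiff_exp_mul μ).continuous.continuousOn, ?_,
    tendsto_exp_mul_nhdsWithin_zero _ _⟩
  filter_upwards [coeFn_expLeft hμ] with x hx h
  rw [hx, indicator_of_mem h]

lemma hasLeftValue_expRight : HasLeftValue (expRight μ hμ) 0 := by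
  refine ⟨fun _ => 0, continuousOn_const, ?_, tendsto_const_nhds⟩
  filter_upwards [coeFn_expRight hμ] with x hx h
  rw [hx, indicator_of_notMem (notMem_Ioi.mpr (le_of_lt h))]

lemma hasRightValue_expLeft : HasRightValue (expLeft μ hμ) 0 := by
  refine ⟨fun _ => 0, continuousOn_const, ?_, tendsto_const_nhds⟩
  filter_upwards [coeFn_expLeft hμ] with x hx h
  rw [hx, indicator_of_notMem (notMem_Iio.mpr (le_of_lt h))]

lemma norm_sq_of_indicator_exp_mul {S : Set ℝ} (hS : MeasurableSet S) {m : ℂ} {f : L2R}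
    (hf : f =ᵐ[volume] S.indicator fun x : ℝ => Complex.exp (m * x)) :
    ‖f‖ ^ 2 = ∫ x in S, Real.exp (2 * m.re * x) := by
  have h : ((‖f‖ ^ 2 : ℝ) : ℂ) = ((∫ x in S, Real.exp (2 * m.re * x) : ℝ) : ℂ) := by
    have e := inner_self_eq_norm_sq_to_K (𝕜 := ℂ) f
    rw [L2.inner_def] at e
    rw [Complex.ofReal_pow]
    refine (e.symm.trans ?_)
    rw [← integral_indicator hS, ← integral_complex_ofReal]
    refine integral_congr_ae ?_
    filter_upwards [hf] with x hx
    rw [hx, inner_self_eq_norm_sq_to_K]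
    by_cases hxS : x ∈ S
    · simp only [indicator_of_mem hxS, ← norm_exp_mul_sq]
      simp
    · simp [hxS]
  exact_mod_cast h

lemma norm_expRight_sq : ‖expRight μ hμ‖ ^ 2 = 1 / (2 * μ.re) := by
  rw [norm_sq_of_indicator_exp_mul measurableSet_Ioi (coeFn_expRight hμ),
    integral_exp_mul_Ioi (by simpa using hμ)]
  simp

lemma norm_expLeft_sq : ‖expLeft μ hμ‖ ^ 2 = 1 / (2 * μ.re) := by
  rw [norm_sq_of_indicator_exp_mul measurableSet_Iio (coeFn_expLeft hμ),
    ← integral_Iic_eq_integral_Iio, integral_exp_mul_Iic (by simpa using hμ)]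
  simp

lemma inner_expRight_expLeft : inner ℂ (expRight μ hμ) (expLeft μ hμ) = 0 := by
  rw [L2.inner_def, ← integral_zero ℝ ℂ (μ := volume)]
  refine integral_congr_ae ?_
  filter_upwards [coeFn_expRight hμ, coeFn_expLeft hμ] with x h1 h2
  rw [h1, h2]
  by_cases h : 0 < x
  · rw [indicator_of_notMem (s := Iio 0) (notMem_Iio.mpr h.le), inner_zero_right]
  · rw [indicator_of_notMem (s := Ioi 0) h, inner_zero_left]

/-- Pythagoras for disjoint supports. The last factor depends only on `Re μ`, so it cancels when
exponents with equal real parts are compared. -/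
lemma norm_smul_expRight_add_smul_expLeft (A B : ℂ) :
    ‖A • expRight μ hμ + B • expLeft μ hμ‖
      = √(‖A‖ ^ 2 + ‖B‖ ^ 2) * √(1 / (2 * μ.re)) := by
  rw [← Real.sqrt_mul (by positivity), eq_comm, Real.sqrt_eq_iff_mul_self_eq (by positivity)
    (norm_nonneg _), 
    norm_add_sq_eq_norm_sq_add_norm_sq_of_inner_eq_zero
      (𝕜 := ℂ), norm_smul, norm_smul]
  · have h1 := norm_expRight_sq hμ
    have h2 := norm_expLeft_sq hμ
    linear_combination -‖A‖ ^ 2 * h1 - ‖B‖ ^ 2 * h2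
  · rw [inner_smul_left, inner_smul_right, inner_expRight_expLeft, mul_zero, mul_zero]

end

/-! ### Testing the resolvent estimate on exponentials -/

/-- If a combination of decaying exponentials with exponents `μ` and `ν` satisfies the boundary
condition, then a resolvent bound at `-μ²` controls the `μ` part by the `ν` part. -/
lemma sqrt_norm_sq_add_norm_sq_le {T : Matrix (Fin 2) (Fin 2) ℂ} {M : ℝ} {μ ν : ℂ}
    (hμ : 0 < μ.re) (hν : ν.re = μ.re)
    (hM : ∀ f : (operator T).domain, |(-μ ^ 2).im| * ‖(f : L2R)‖
      ≤ M * ‖operator T f - (-μ ^ 2) • (f : L2R)‖)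
    {α A β B : ℂ}
    (hT : T *ᵥ Gamma0 (α + A) (β + B) (-ν * α + -μ * A) (ν * β + μ * B)
      = Gamma1 (α + A) (β + B) (-ν * α + -μ * A) (ν * β + μ * B)) :
    |(-μ ^ 2).im| * √(‖A‖ ^ 2 + ‖B‖ ^ 2)
      ≤ (M * ‖μ ^ 2 - ν ^ 2‖ + |(-μ ^ 2).im|) * √(‖α‖ ^ 2 + ‖β‖ ^ 2) := by
  have hν' : 0 < ν.re := hν ▸ hμ
  set e := α • expRight ν hν' + β • expLeft ν hν' with he
  set k := A • expRight μ hμ + B • expLeft μ hμ with hk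
  have hRe := hasWeakDeriv_expRight hν'
  have hLe := hasWeakDeriv_expLeft hν'
  have hRk := hasWeakDeriv_expRight hμ
  have hLk := hasWeakDeriv_expLeft hμ
  have d1 : HasWeakDeriv (e + k) _ :=
    ((hRe.smul α).add (hLe.smul β)).add ((hRk.smul A).add (hLk.smul B))
  have d2 := (((hRe.smul (-ν)).smul α).add ((hLe.smul ν).smul β)).add
    (((hRk.smul (-μ)).smul A).add ((hLk.smul μ).smul B))
  have r1 := hasRightValue_expRight hν'
  have r2 := hasRightValue_expLeft hν'
  have r3 := hasRightValue_expRight hμ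
  have r4 := hasRightValue_expLeft hμ
  have l1 := hasLeftValue_expRight hν'
  have l2 := hasLeftValue_expLeft hν'
  have l3 := hasLeftValue_expRight hμ
  have l4 := hasLeftValue_expLeft hμ
  have bc : BoundaryCondition T (e + k) (α • -ν • expRight ν hν' + β • ν • expLeft ν hν' +
      (A • -μ • expRight μ hμ + B • μ • expLeft μ hμ)) := by
    refine ⟨_, _, _, _, ((r1.smul α).add (r2.smul β)).add ((r3.smul A).add (r4.smul B)),
      ((l1.smul α).add (l2.smul β)).add ((l3.smul A).add (l4.smul B)),
      (((r1.smul (-ν)).smul α).add ((r2.smul ν).smul β)).add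
        (((r3.smul (-μ)).smul A).add ((r4.smul μ).smul B)),
      (((l1.smul (-ν)).smul α).add ((l2.smul ν).smul β)).add
        (((l3.smul (-μ)).smul A).add ((l4.smul μ).smul B)), ?_⟩
    convert hT using 3 <;> ring
  obtain ⟨f, hf1, hf2⟩ := LinearPMap.mem_graph_iff _ |>.mp
    (mem_graph_operator.mpr ⟨_, _, d1, d2, bc, rfl⟩)
  have hb := hM f
  -- Formally `-d²/dx²` multiplies `k` by `-μ²` and `e` by `-ν²`, so subtracting `-μ²` removes `k`.
  have hop : operator T f - (-μ ^ 2) • (f : L2R) = (μ ^ 2 - ν ^ 2) • e := by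
    rw [hf2, hf1, he, hk]
    module
  rw [hop, hf1, norm_smul] at hb
  have hN : 0 < √(1 / (2 * μ.re)) := by positivity
  have he' := norm_smul_expRight_add_smul_expLeft hν' α β
  have hk' := norm_smul_expRight_add_smul_expLeft hμ A B
  rw [← he, hν] at he'
  rw [← hk] at hk'
  have htri : ‖k‖ ≤ ‖e + k‖ + ‖e‖ := by
    simpa [add_comm] using norm_sub_le (e + k) e
  refine le_of_mul_le_mul_right ?_ hN
  rw [mul_assoc, mul_assoc, ← hk', ← he']
  nlinarith [mul_le_mul_of_nonneg_left htri (abs_nonneg (-μ ^ 2).im)]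

/-- The similarity bound on the coefficients of exponentials `exp (± i τ x)` in terms of those of
`exp (∓ i (conj τ) x)`, uniformly over the open first quadrant. -/
lemma IsSimilarToSelfAdjoint.exists_coeff_bound {T : Matrix (Fin 2) (Fin 2) ℂ}
    (hA : IsSimilarToSelfAdjoint (operator T)) :
    ∃ C : ℝ, 0 ≤ C ∧ ∀ τ : ℂ, 0 < τ.re → 0 < τ.im → ∀ α A β B : ℂ,
      T *ᵥ Gamma0 (α + A) (β + B)
          (-(Complex.I * star τ) * α + Complex.I * τ * A)
          (Complex.I * star τ * β + -(Complex.I * τ) * B)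
        = Gamma1 (α + A) (β + B)
          (-(Complex.I * star τ) * α + Complex.I * τ * A)
          (Complex.I * star τ * β + -(Complex.I * τ) * B) →
      √(‖A‖ ^ 2 + ‖B‖ ^ 2) ≤ C * √(‖α‖ ^ 2 + ‖β‖ ^ 2) := by
  obtain ⟨M, hM0, hM⟩ := hA.exists_abs_im_mul_norm_le
  refine ⟨2 * M + 1, by positivity, fun τ hre him α A β B hT => ?_⟩
  -- Here `ν` is the conjugate of `μ = -iτ`, both have real part `Im τ > 0`, and the spectral
  -- parameter is `-μ² = τ²`. Since `|μ² - ν²| = 2 |Im τ²|`, the constant becomes `2 M + 1`.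
  have key := sqrt_norm_sq_add_norm_sq_le (T := T) (M := M) (μ := -(Complex.I * τ))
    (ν := Complex.I * star τ) (α := α) (A := A) (β := β) (B := B) (by simpa using him) (by simp)
    (hM _) (by rwa [neg_neg])
  have h1 : -(-(Complex.I * τ)) ^ 2 = τ ^ 2 := by
    linear_combination -τ ^ 2 * Complex.I_sq
  have h2 : |(τ ^ 2).im| = 2 * τ.re * τ.im := by
    have e : (τ ^ 2).im = 2 * τ.re * τ.im := by
      rw [sq, Complex.mul_im]
      ring
    rw [e, abs_of_nonneg (by positivity)]
  have h3 : ‖(-(Complex.I * τ)) ^ 2 - (Complex.I * star τ) ^ 2‖ = 4 * τ.re * τ.im := by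
    have : (-(Complex.I * τ)) ^ 2 - (Complex.I * star τ) ^ 2
        = ((4 * τ.re * τ.im : ℝ) : ℂ) * -Complex.I := by
      have hconj : τ - star τ = ((2 * τ.im : ℝ) : ℂ) * Complex.I := Complex.sub_conj τ
      have hadd : τ + star τ = ((2 * τ.re : ℝ) : ℂ) := Complex.add_conj τ
      push_cast at hconj hadd ⊢
      linear_combination (τ ^ 2 - star τ ^ 2) * Complex.I_sq - (τ - star τ) * hadd
        - 2 * (τ.re : ℂ) * hconj
    rw [this, norm_mul, norm_neg, Complex.norm_I, mul_one, Complex.norm_real, Real.norm_eq_abs,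
      abs_of_nonneg (by positivity)]
  rw [h1, h2, h3] at key
  have hpos : 0 < 2 * τ.re * τ.im := by positivity
  refine le_of_mul_le_mul_left (key.trans_eq ?_) hpos
  ring

/-! ### The boundary system and its determinant -/

lemma mulVec_Gamma0_eq_Gamma1_iff {a b c d fp fm dfp dfm : ℂ} :
    !![a, b; c, d] *ᵥ Gamma0 fp fm dfp dfm = Gamma1 fp fm dfp dfm ↔
      a * ((fp + fm) / 2) + b * ((-dfp - dfm) / 2) = dfp - dfm ∧
      c * ((fp + fm) / 2) + d * ((-dfp - dfm) / 2) = fp - fm := by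
  rw [funext_iff, Fin.forall_fin_two]
  simp [Gamma0, Gamma1, Matrix.mulVec, dotProduct, Fin.sum_univ_two]

lemma p_eq (a b c d τ : ℂ) :
    p a b c d τ = 2 * d * τ ^ 2 + Complex.I * (a * d - b * c - 4) * τ + 2 * a := by
  rw [p, Matrix.det_fin_two_of]

/-- At a zero of `p` there is a nontrivial combination of `exp (± i τ x)` satisfying the boundary
condition. -/
lemma exists_ne_zero_of_p_eq_zero {a b c d τ : ℂ} (h : p a b c d τ = 0) :
    ∃ A B : ℂ, (A ≠ 0 ∨ B ≠ 0) ∧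
      !![a, b; c, d] *ᵥ Gamma0 A B (Complex.I * τ * A) (-(Complex.I * τ) * B)
        = Gamma1 A B (Complex.I * τ * A) (-(Complex.I * τ) * B) := by
  rw [p_eq] at h
  have hI := Complex.I_sq
  -- The boundary condition in the unknowns mean `(A + B)/2` and jump `A - B`; its determinant is
  -- `-p/2`.
  let N : Matrix (Fin 2) (Fin 2) ℂ :=
    !![a - 2 * Complex.I * τ, -(b * Complex.I * τ / 2); c, -(d * Complex.I * τ / 2) - 1]
  have hN : N.det = 0 := by
    rw [Matrix.det_fin_two_of]
    linear_combination -(1 / 2) * h + d * τ ^ 2 * hI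
  obtain ⟨v, hv, hNv⟩ := Matrix.exists_mulVec_eq_zero_iff.mpr hN
  rw [funext_iff, Fin.forall_fin_two] at hNv
  simp only [N, Matrix.mulVec, dotProduct, Fin.sum_univ_two, Matrix.of_apply, Matrix.cons_val_zero,
    Matrix.cons_val_one, Pi.zero_apply, Matrix.cons_val', Matrix.cons_val_fin_one] at hNv
  obtain ⟨e1, e2⟩ := hNv
  refine ⟨v 0 + v 1 / 2, v 0 - v 1 / 2, ?_, mulVec_Gamma0_eq_Gamma1_iff.mpr ⟨?_, ?_⟩⟩
  · by_contra! hcon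
    apply hv
    ext i
    fin_cases i
    · change v 0 = 0
      linear_combination (hcon.1 + hcon.2) / 2
    · change v 1 = 0
      linear_combination hcon.1 - hcon.2
  · linear_combination e1
  · linear_combination e2

/-- The boundary condition with a unit source in the derivative on the side given by the sign `ε`
is solved by a mean `s` and a jump `q` of the boundary values, which have denominator `p`. -/
lemma exists_mean_jump {a b c d τ ε : ℂ} (hε : ε ^ 2 = 1) (h : p a b c d τ ≠ 0) :
    ∃ s q : ℂ, (a - 2 * Complex.I * τ) * s - b * Complex.I * τ / 2 * q = 1 + ε * b / 2 ∧
      c * s - (d * Complex.I * τ / 2 + 1) * q = ε * d / 2 ∧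
      2 * d * τ ^ 2 + Complex.I * τ * ((!![a, b; c, d]).det - ε * (2 * c))
        = -(ε * (Complex.I * τ * q)) * p a b c d τ ∧
      Complex.I * τ * ((!![a, b; c, d]).det + ε * (2 * b)) + 2 * a
        = (1 + 2 * Complex.I * τ * s) * p a b c d τ := by
  have hI := Complex.I_sq
  have hp := p_eq a b c d τ
  rw [Matrix.det_fin_two_of]
  -- The numerators of `s` and `q` come from Cramer's rule, and `ε² = 1` is used in the identity for
  -- `q` below.
  obtain ⟨s, hs⟩ : ∃ s, s * p a b c d τ = d * Complex.I * τ + 2 + ε * b :=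
    ⟨_, div_mul_cancel₀ _ h⟩
  obtain ⟨q, hq⟩ : ∃ q, q * p a b c d τ
      = 2 * c + ε * (b * c - a * d + 2 * Complex.I * τ * d) := ⟨_, div_mul_cancel₀ _ h⟩
  refine ⟨s, q, mul_right_cancel₀ h ?_, mul_right_cancel₀ h ?_, ?_, ?_⟩
  · linear_combination (a - 2 * Complex.I * τ) * hs - b * Complex.I * τ / 2 * hq
      - (2 * d * τ ^ 2 + ε * b * d * τ ^ 2) * hI - (1 + ε * b / 2) * hp
  · linear_combination c * hs - (d * Complex.I * τ / 2 + 1) * hq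
      - ε * d ^ 2 * τ ^ 2 * hI - ε * d / 2 * hp
  · linear_combination ε * Complex.I * τ * hq + 2 * d * τ ^ 2 * hI
      + (2 * d * τ ^ 2 * Complex.I ^ 2 - Complex.I * τ * (a * d - b * c)) * hε
  · linear_combination -hp - 2 * Complex.I * τ * hs - 2 * d * τ ^ 2 * hI

/-! ### Uniform bounds on the quadrant -/

/-- The factor `P` cancels, leaving `(Re τ |q|)² + (Re τ |1 + 2iτs| / |τ|)²`; the summand `1` is
absorbed by `Re τ ≤ |τ|`. -/
lemma quotient_le_of_norm_le {τ P w₁ w₂ s q ε : ℂ} {D : ℝ} (hre : 0 < τ.re) (hP : P ≠ 0)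
    (hε : ‖ε‖ = 1) (hw₁ : w₁ = -(ε * (Complex.I * τ * q)) * P)
    (hw₂ : w₂ = (1 + 2 * Complex.I * τ * s) * P) (hs : 2 * τ.re * ‖s‖ ≤ D)
    (hq : τ.re * ‖q‖ ≤ D) :
    τ.re ^ 2 / ‖τ‖ ^ 2 * ((‖w₁‖ ^ 2 + ‖w₂‖ ^ 2) / ‖P‖ ^ 2) ≤ D ^ 2 + (1 + D) ^ 2 := by
  have hτ : 0 < ‖τ‖ := norm_pos_iff.mpr fun h => by simp [h] at hre
  have hPn : 0 < ‖P‖ := norm_pos_iff.mpr hP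
  have hle : τ.re ≤ ‖τ‖ := Complex.re_le_norm τ
  have n₁ : ‖w₁‖ = ‖τ‖ * ‖q‖ * ‖P‖ := by simp [hw₁, hε]
  have n₂ : ‖w₂‖ = ‖1 + 2 * Complex.I * τ * s‖ * ‖P‖ := by rw [hw₂, norm_mul]
  have n₃ : τ.re * ‖1 + 2 * Complex.I * τ * s‖ ≤ (1 + D) * ‖τ‖ := by
    have : ‖1 + 2 * Complex.I * τ * s‖ ≤ 1 + 2 * ‖τ‖ * ‖s‖ :=
      (norm_add_le _ _).trans_eq (by simp)
    nlinarith [mul_le_mul_of_nonneg_left this hre.le, mul_le_mul_of_nonneg_left hs hτ.le]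
  have e : τ.re ^ 2 / ‖τ‖ ^ 2 * ((‖w₁‖ ^ 2 + ‖w₂‖ ^ 2) / ‖P‖ ^ 2)
      = (τ.re * ‖q‖) ^ 2 + (τ.re * ‖1 + 2 * Complex.I * τ * s‖ / ‖τ‖) ^ 2 := by
    rw [n₁, n₂]
    field_simp
  rw [e]
  gcongr
  exact (div_le_iff₀ hτ).mpr n₃

lemma IsSimilarToSelfAdjoint.p_ne_zero {a b c d : ℂ}
    (hA : IsSimilarToSelfAdjoint (operator !![a, b; c, d])) {τ : ℂ} (hre : 0 < τ.re)
    (him : 0 < τ.im) : p a b c d τ ≠ 0 := by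
  obtain ⟨C, -, hC⟩ := hA.exists_coeff_bound
  intro h
  obtain ⟨A, B, hne, hAB⟩ := exists_ne_zero_of_p_eq_zero h
  -- With `α = β = 0` the right-hand side vanishes: a genuine eigenfunction at the non-real point
  -- `τ²` is excluded.
  have hle := hC τ hre him 0 A 0 B (by simpa using hAB)
  rw [norm_zero, zero_pow two_ne_zero, add_zero, Real.sqrt_zero, mul_zero,
    Real.sqrt_le_left le_rfl, zero_pow two_ne_zero] at hle
  have hA0 : ‖A‖ ^ 2 = 0 := by nlinarith [sq_nonneg ‖A‖, sq_nonneg ‖B‖]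
  have hB0 : ‖B‖ ^ 2 = 0 := by nlinarith [sq_nonneg ‖A‖, sq_nonneg ‖B‖]
  rcases hne with hne | hne
  · exact hne (by simpa using hA0)
  · exact hne (by simpa using hB0)

/-- The mean and the jump of the boundary values are controlled by `1 / Re τ`. -/
lemma norm_mean_jump_le {a b c d τ s q ε : ℂ} {C : ℝ} (hC0 : 0 ≤ C) (hre : 0 < τ.re)
    (hC : ∀ α A β B : ℂ,
      !![a, b; c, d] *ᵥ Gamma0 (α + A) (β + B)
          (-(Complex.I * star τ) * α + Complex.I * τ * A)
          (Complex.I * star τ * β + -(Complex.I * τ) * B)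
        = Gamma1 (α + A) (β + B)
          (-(Complex.I * star τ) * α + Complex.I * τ * A)
          (Complex.I * star τ * β + -(Complex.I * τ) * B) →
      √(‖A‖ ^ 2 + ‖B‖ ^ 2) ≤ C * √(‖α‖ ^ 2 + ‖β‖ ^ 2))
    (hε : ε = 1 ∨ ε = -1)
    (h1 : (a - 2 * Complex.I * τ) * s - b * Complex.I * τ / 2 * q = 1 + ε * b / 2)
    (h2 : c * s - (d * Complex.I * τ / 2 + 1) * q = ε * d / 2) :
    2 * τ.re * ‖s‖ ≤ C + 1 ∧ τ.re * ‖q‖ ≤ C + 1 := by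
  -- Replacing `exp(iτx)` by `exp(-i (conj τ) x)` with amplitude `κ` keeps the boundary value and
  -- shifts the right derivative by `-i(τ + conj τ)κ = 1`: the unit source in `h1` and `h2`.
  obtain ⟨κ, hκ, hκn⟩ : ∃ κ : ℂ, Complex.I * (τ + star τ) * κ = -1 ∧ 2 * τ.re * ‖κ‖ = 1 := by
    have hre' : (τ.re : ℂ) ≠ 0 := by exact_mod_cast hre.ne'
    have hadd : τ + star τ = 2 * (τ.re : ℂ) := by
      simpa using Complex.add_conj τ
    refine ⟨Complex.I / (2 * τ.re), ?_, ?_⟩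
    · rw [hadd]
      field_simp
      exact Complex.I_sq
    · rw [norm_div, norm_mul, Complex.norm_I, Complex.norm_real, Complex.norm_ofNat,
        Real.norm_of_nonneg hre.le]
      field_simp
  -- For `ε = 1` the source sits on the right half-line, for `ε = -1` on the left.
  set α := (1 + ε) / 2 * κ with hα
  set β := (1 - ε) / 2 * κ with hβ
  have hle := hC α (s + q / 2 - α) β (s - q / 2 - β) (mulVec_Gamma0_eq_Gamma1_iff.mpr ⟨by
    linear_combination h1 + (b / 2 * ε + 1) * hκ, by
    linear_combination h2 + d / 2 * ε * hκ⟩)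
  have hαβ : ‖α‖ ^ 2 + ‖β‖ ^ 2 = ‖κ‖ ^ 2 ∧ ‖α‖ + ‖β‖ = ‖κ‖ := by
    rcases hε with rfl | rfl <;> norm_num [hα, hβ]
  rw [hαβ.1, Real.sqrt_sq (norm_nonneg κ)] at hle
  have hA : ‖s + q / 2 - α‖ ≤ C * ‖κ‖ :=
    (Real.le_sqrt_of_sq_le (by linarith [sq_nonneg ‖s - q / 2 - β‖])).trans hle
  have hB : ‖s - q / 2 - β‖ ≤ C * ‖κ‖ :=
    (Real.le_sqrt_of_sq_le (by linarith [sq_nonneg ‖s + q / 2 - α‖])).trans hle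
  have hsum : ‖2 * s‖ ≤ 2 * (C * ‖κ‖) + ‖κ‖ := by
    calc ‖2 * s‖ = ‖((s + q / 2 - α) + (s - q / 2 - β)) + (α + β)‖ := by congr 1; ring
      _ ≤ ‖s + q / 2 - α‖ + ‖s - q / 2 - β‖ + (‖α‖ + ‖β‖) :=
        (norm_add_le _ _).trans (add_le_add (norm_add_le _ _) (norm_add_le _ _))
      _ ≤ _ := by linarith [hαβ.2]
  have hdiff : ‖q‖ ≤ 2 * (C * ‖κ‖) + ‖κ‖ := by
    calc ‖q‖ = ‖((s + q / 2 - α) - (s - q / 2 - β)) + (α - β)‖ := by congr 1; ring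
      _ ≤ ‖s + q / 2 - α‖ + ‖s - q / 2 - β‖ + (‖α‖ + ‖β‖) :=
        (norm_add_le _ _).trans (add_le_add (norm_sub_le _ _) (norm_sub_le _ _))
      _ ≤ _ := by linarith [hαβ.2]
  rw [norm_mul, Complex.norm_ofNat] at hsum
  constructor
  · nlinarith [mul_le_mul_of_nonneg_left hsum hre.le]
  · nlinarith [mul_le_mul_of_nonneg_left hdiff hre.le]

end ZeroRange

theorem lemma5 (a b c d : ℂ)
    (hA : ZeroRange.IsSimilarToSelfAdjoint (ZeroRange.operator !![a, b; c, d])) :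
    (∀ τ : ℂ, 0 < τ.re → 0 < τ.im → ZeroRange.p a b c d τ ≠ 0) ∧
      ∃ K : ℝ, 0 < K ∧ ∀ τ : ℂ, 0 < τ.re → 0 < τ.im →
        ZeroRange.PhiPlus a b c d τ < K ∧ ZeroRange.PhiMinus a b c d τ < K := by
  refine ⟨fun τ hre him => hA.p_ne_zero hre him, ?_⟩
  obtain ⟨C, hC0, hC⟩ := hA.exists_coeff_bound
  -- This is the bound of `quotient_le_of_norm_le` at `D = C + 1`; the extra `1` makes the
  -- inequality strict.
  refine ⟨(C + 1) ^ 2 + (1 + (C + 1)) ^ 2 + 1, by positivity, fun τ hre him => ?_⟩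
  have hp := hA.p_ne_zero hre him
  constructor
  · obtain ⟨s, q, h1, h2, h3, h4⟩ := ZeroRange.exists_mean_jump (ε := 1) (by norm_num) hp
    obtain ⟨hs, hq⟩ := ZeroRange.norm_mean_jump_le hC0 hre (hC τ hre him) (Or.inl rfl) h1 h2
    have := ZeroRange.quotient_le_of_norm_le hre hp (by simp) h3 h4 hs hq
    simp only [one_mul] at this
    exact lt_of_le_of_lt this (lt_add_one _)
  · obtain ⟨s, q, h1, h2, h3, h4⟩ := ZeroRange.exists_mean_jump (ε := -1) (by norm_num) hp
    obtain ⟨hs, hq⟩ := ZeroRange.norm_mean_jump_le hC0 hre (hC τ hre him) (Or.inr rfl) h1 h2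
    have := ZeroRange.quotient_le_of_norm_le hre hp (by simp) h3 h4 hs hq
    simp only [neg_mul, one_mul, sub_neg_eq_add, ← sub_eq_add_neg] at this
    exact lt_of_le_of_lt this (lt_add_one _)
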